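/- Let $k\ge 2$ be an integer, $(X,\mathscr{B},\mu)$ a probability space, and $S_1,\dots,S_{k-1}:X\to X$ measure preserving automorphisms (invertible, bi-measurable, $\mu$-preserving maps) that commute pairwise up to $\mu$-null sets. Let $p\in\mathbb{R}[x]$ have degree at least $k$ and irrational leading coefficient, and let $f_1,\dots,f_{k-1}\in L^\infty(X,\mu)$ be complex valued. Writing $S_i^nf=f\circ S_i^n$, the sequence $$\left(S_1^nf_1\,S_2^nf_2\cdots S_{k-1}^nf_{k-1}\,e^{2\pi i p(n)}\right)_{n=1}^\infty$$ of vectors in $L^2(X,\mu)$ is spectrally Lebesgue. Here a sequence $(a_n)_{n=1}^\infty$ in a complex Hilbert space $\mathcal{H}$ is called spectrally Lebesgue if $\limsup_{N\to\infty}\frac1N\sum_{n=1}^N\|a_n\|^2<\infty$ and, for every strictly increasing sequence $(N_q)_{q=1}^\infty$ of positive integers for which the limits $$\gamma(h):=\lim_{q\to\infty}\frac{1}{N_q}\sum_{n=1}^{N_q}\langle a_{n+h},a_n\rangle$$ exist for all integers $h\ge 0$, there is a finite positive measure $\sigma$ on $[0,1]$, absolutely continuous with respect to Lebesgue measure, such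 that $\gamma(h)=\int_0^1 e^{-2\pi i h x}\,d\sigma(x)$ for all integers $h\ge 0$. -/

import Mathlib

open Filter Topology MeasureTheory Polynomial
open scoped ENNReal

noncomputable section

namespace VanDerCorput

section Sequences

variable {H : Type*} [NormedAddCommGroup H] [InnerProductSpace ℂ H]

/-- The class `SA(H)` of square averageable sequences `(f_n)_{n ≥ 1}` in `H`: those with
`limsup_N (1/N) ∑_{n=1}^N ‖f_n‖² < ∞`. Sequences are indexed by `ℕ`, but only the terms with
index `n ≥ 1` ever matter. Boundedness along `atTop` is finiteness of the limit superior. -/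
def SquareAverageable (f : ℕ → H) : Prop :=
  IsBoundedUnder (· ≤ ·) atTop (fun N : ℕ => (1 / (N : ℝ)) * ∑ n ∈ Finset.Icc 1 N, ‖f n‖ ^ 2)

/-- The correlation average `(1/N) ∑_{n=1}^N ⟨x_{n+h}, y_n⟩`. The mathematical inner product is
linear in its first slot while `inner ℂ` is linear in its second slot, so
`⟨u, v⟩` is `inner ℂ v u`. -/
def correlationAverage (x y : ℕ → H) (h N : ℕ) : ℂ :=
  (1 / (N : ℂ)) * ∑ n ∈ Finset.Icc 1 N, inner ℂ (y n) (x (n + h))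

/-- `((f_n), (g_n), (N_q))` is a permissible triple: `f` and `g` are square averageable, `(N_q)` is
an increasing sequence of positive integers, and
`⟨(x_{n+h})_n, (y_n)_n⟩ := lim_q (1/N_q) ∑_{n=1}^{N_q} ⟨x_{n+h}, y_n⟩`, the inner product of the
induced Hilbert space, exists for all `x, y ∈ {f, g}` and all `h ≥ 0`. -/
structure IsPermissibleTriple (f g : ℕ → H) (N : ℕ → ℕ) : Prop where
  squareAverageable_left : SquareAverageable f
  squareAverageable_right : SquareAverageable g
  strictMono : StrictMono N
  pos : ∀ q, 0 < N q
  exists_limit : ∀ x ∈ ({f, g} : Set (ℕ → H)), ∀ y ∈ ({f, g} : Set (ℕ → H)), ∀ h : ℕ,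
    ∃ c : ℂ, Tendsto (fun q => correlationAverage x y h (N q)) atTop (𝓝 c)

/-- The inner product `⟨(x_{n+h})_n, (y_n)_n⟩` in the Hilbert space induced by a permissible triple
with averaging sequence `(N_q)`. -/
def inducedInner (N : ℕ → ℕ) (x y : ℕ → H) (h : ℕ) : ℂ :=
  limUnder atTop (fun q => correlationAverage x y h (N q))

/-- The Fourier coefficient `∫ e^{-2πihx} dσ(x)` of a measure `σ`. -/
def measureFourierCoeff (σ : Measure ℝ) (h : ℤ) : ℂ :=
  ∫ x, Complex.exp (-(2 * Real.pi * Complex.I * h * x)) ∂σ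

/-- A square averageable sequence `f` is spectrally Lebesgue if for every permissible triple
`(f, f, (N_q))` the numbers `⟨(f_{n+h})_n, (f_n)_n⟩` in the induced Hilbert space are the Fourier
coefficients of a finite positive measure on `[0,1]` that is absolutely continuous with respect to
Lebesgue measure on `[0,1]`. -/
def SpectrallyLebesgue (f : ℕ → H) : Prop :=
  SquareAverageable f ∧
    ∀ N : ℕ → ℕ, IsPermissibleTriple f f N →
      ∃ σ : Measure ℝ, IsFiniteMeasure σ ∧ σ ≪ volume.restrict (Set.Icc 0 1) ∧
        ∀ h : ℕ, inducedInner N f f h = measureFourierCoeff σ h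

end Sequences

section Systems

variable {X : Type*} [MeasurableSpace X] {μ : Measure X} [IsProbabilityMeasure μ]

/-- For essentially bounded `f_i`, the function `∏_i (f_i ∘ S_i^n) · e^{2πi p(n)}` is in `L²`. -/
theorem memLp_twistedProduct {m : ℕ} (S : Fin m → X ≃ᵐ X)
    (hS : ∀ i, MeasurePreserving (S i) μ μ) (f : Fin m → Lp ℂ ∞ μ) (p : ℝ[X]) (n : ℕ) :
    MemLp (fun x => (∏ i, f i ((S i)^[n] x)) *
      Complex.exp (2 * Real.pi * Complex.I * (p.eval (n : ℝ) : ℝ))) 2 μ := by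
  have key : ∀ s : Finset (Fin m), MemLp (fun x => ∏ i ∈ s, f i ((S i)^[n] x)) ∞ μ := by
    intro s
    induction s using Finset.induction_on with
    | empty => simpa using memLp_const (1 : ℂ)
    | insert a s ha ih =>
      simp only [Finset.prod_insert ha]
      exact ih.mul ((Lp.memLp (f a)).comp_measurePreserving ((hS a).iterate n))
  exact ((key Finset.univ).mono_exponent le_top).mul_const _

/-- The sequence `n ↦ S_1^n f_1 ⋯ S_m^n f_m e^{2πi p(n)}` in `L²(X, μ)`, where
`S^n f = f ∘ S^n`. -/
def twistedProduct {m : ℕ} (S : Fin m → X ≃ᵐ X)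
    (hS : ∀ i, MeasurePreserving (S i) μ μ) (f : Fin m → Lp ℂ ∞ μ) (p : ℝ[X]) (n : ℕ) :
    Lp ℂ 2 μ :=
  (memLp_twistedProduct S hS f p n).toLp

end Systems

end VanDerCorput

end

/-! Every correlation at a lag `h ≥ 1` tends to zero, so the spectral measure is a constant multiple
of Lebesgue measure, the constant being the lag-zero limit.

At lag `h` the phase becomes `p(n+h) - p(n)`: the degree falls by one and the leading coefficient is
multiplied by `h · deg p`, hence stays irrational. The remaining factor is the integral of `∏ S_i^n
(conj f_i · S_i^h f_i)`. Invariance of the integral under `S_a^{-n}` frees one factor from its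
dependence on `n`, leaving a fixed vector paired with a product over the commuting maps `S_a⁻¹ S_i`,
`i ≠ a`. It thus suffices that products of at most `d` factors twisted by a phase of degree `d + 1`
have vanishing Cesàro means in norm (`tendsto_cesaro_twistedVec`). Van der Corput's lemma
(`tendsto_cesaro_of_correlation`) reduces this to correlations, to which the same reduction applies;
the induction ends at a geometric sum with irrational rotation. -/

namespace VanDerCorput

/-! ### Cesàro means and their shift invariance. -/

section Cesaro

variable {E : Type*} [NormedAddCommGroup E] [NormedSpace ℂ E]

/-- The Cesàro mean `(1/N) ∑_{n=1}^N z_n`. -/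
noncomputable def cesaro (z : ℕ → E) (N : ℕ) : E := (N : ℂ)⁻¹ • ∑ n ∈ Finset.Icc 1 N, z n

theorem cesaro_sum {ι : Type*} (s : Finset ι) (z : ι → ℕ → E) (N : ℕ) :
    cesaro (fun n => ∑ i ∈ s, z i n) N = ∑ i ∈ s, cesaro (z i) N := by
  simp only [cesaro, ← Finset.smul_sum]
  rw [Finset.sum_comm]

theorem norm_cesaro_le {z : ℕ → E} {C : ℝ} (hC : ∀ n, ‖z n‖ ≤ C) (N : ℕ) : ‖cesaro z N‖ ≤ C := by
  have hC0 : 0 ≤ C := (norm_nonneg _).trans (hC 0)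
  rcases Nat.eq_zero_or_pos N with rfl | hN
  · simpa [cesaro] using hC0
  have hN' : (0 : ℝ) < N := by exact_mod_cast hN
  rw [cesaro, norm_smul, norm_inv, Complex.norm_natCast, inv_mul_le_iff₀ hN']
  calc ‖∑ n ∈ Finset.Icc 1 N, z n‖ ≤ ∑ n ∈ Finset.Icc 1 N, C := norm_sum_le_of_le _ fun n _ => hC n
    _ = N * C := by simp

theorem tendsto_cesaro_of_norm_sum_le {z : ℕ → E} {B : ℝ}
    (hB : ∀ N, ‖∑ n ∈ Finset.Icc 1 N, z n‖ ≤ B) : Tendsto (cesaro z) atTop (𝓝 0) := by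
  have hlim : Tendsto (fun N : ℕ => (N : ℝ)⁻¹ * B) atTop (𝓝 0) := by
    simpa using (tendsto_inv_atTop_nhds_zero_nat (𝕜 := ℝ)).mul_const B
  refine squeeze_zero_norm (fun N => ?_) hlim
  rw [cesaro, norm_smul, norm_inv, Complex.norm_natCast]
  gcongr
  exact hB N

/-- Differences of consecutive shifts telescope to two boundary terms, which are bounded. -/
theorem tendsto_cesaro_shift_sub {z : ℕ → E} {C : ℝ} (hC : ∀ n, ‖z n‖ ≤ C) (h : ℕ) :
    Tendsto (fun N => cesaro (fun n => z (n + h)) N - cesaro z N) atTop (𝓝 0) := by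
  induction h with
  | zero => simp
  | succ h ih =>
    have key : Tendsto (cesaro fun n => z (n + 1 + h) - z (n + h)) atTop (𝓝 0) := by
      refine tendsto_cesaro_of_norm_sum_le (B := C + C) fun N => ?_
      have : ∑ n ∈ Finset.Icc 1 N, (z (n + 1 + h) - z (n + h)) = z (N + 1 + h) - z (1 + h) := by
        induction N with
        | zero => simp
        | succ N ih => rw [Finset.sum_Icc_succ_top (by omega), ih]; abel
      rw [this]
      exact (norm_sub_le _ _).trans (add_le_add (hC _) (hC _))
    have := key.add ih
    simp only [add_zero] at this
    refine this.congr fun N => ?_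
    simp only [cesaro, Finset.sum_sub_distrib, smul_sub, add_assoc, add_comm 1 h]
    abel

end Cesaro

/-! ### Van der Corput's lemma in a Hilbert space. -/

section VanDerCorputInequality

variable {H : Type*} [NormedAddCommGroup H] [InnerProductSpace ℂ H]

/-- Cauchy–Schwarz. The right side is kept as a mean of inner products so that it can be expanded
into correlations when `y n` is itself a sum. -/
theorem norm_cesaro_sq_le (y : ℕ → H) (N : ℕ) :
    ‖cesaro y N‖ ^ 2 ≤ (cesaro (fun n => inner ℂ (y n) (y n)) N).re := by
  rcases Nat.eq_zero_or_pos N with rfl | hN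
  · simp [cesaro]
  have hN' : (0 : ℝ) < N := by exact_mod_cast hN
  have h1 : ‖∑ n ∈ Finset.Icc 1 N, y n‖ ^ 2 ≤ N * ∑ n ∈ Finset.Icc 1 N, ‖y n‖ ^ 2 := by
    calc ‖∑ n ∈ Finset.Icc 1 N, y n‖ ^ 2 ≤ (∑ n ∈ Finset.Icc 1 N, ‖y n‖) ^ 2 := by
          gcongr; exact norm_sum_le _ _
      _ ≤ _ := by simpa using sq_sum_le_card_mul_sum_sq (s := Finset.Icc 1 N) (f := fun n => ‖y n‖)
  have h2 : (cesaro (fun n => inner ℂ (y n) (y n)) N).re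
      = (N : ℝ)⁻¹ * ∑ n ∈ Finset.Icc 1 N, ‖y n‖ ^ 2 := by
    have : cesaro (fun n => inner ℂ (y n) (y n)) N
        = (((N : ℝ)⁻¹ * ∑ n ∈ Finset.Icc 1 N, ‖y n‖ ^ 2 : ℝ) : ℂ) := by
      simp [cesaro, inner_self_eq_norm_sq_to_K]
    rw [this, Complex.ofReal_re]
  rw [h2, cesaro, norm_smul, norm_inv, Complex.norm_natCast, mul_pow]
  calc (N : ℝ)⁻¹ ^ 2 * ‖∑ n ∈ Finset.Icc 1 N, y n‖ ^ 2
      ≤ (N : ℝ)⁻¹ ^ 2 * (N * ∑ n ∈ Finset.Icc 1 N, ‖y n‖ ^ 2) := by gcongr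
    _ = _ := by field_simp

/-- Shifting both entries of a correlation does not change its limit. -/
theorem tendsto_cesaro_inner_shift {x : ℕ → H} {C : ℝ} (hC : ∀ n, ‖x n‖ ≤ C)
    (hx : ∀ h, 1 ≤ h → Tendsto (cesaro fun n => inner ℂ (x n) (x (n + h))) atTop (𝓝 0))
    {i j : ℕ} (hij : i ≠ j) :
    Tendsto (cesaro fun n => inner ℂ (x (n + i)) (x (n + j))) atTop (𝓝 0) := by
  have hC0 : 0 ≤ C := (norm_nonneg _).trans (hC 0)
  have lt_case : ∀ i j, i < j →
      Tendsto (cesaro fun n => inner ℂ (x (n + i)) (x (n + j))) atTop (𝓝 0) := by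
    intro i j hlt
    obtain ⟨h, rfl⟩ := Nat.exists_eq_add_of_lt hlt
    have hb : ∀ n, ‖inner ℂ (x n) (x (n + (h + 1)))‖ ≤ C * C := fun n =>
      (norm_inner_le_norm _ _).trans (mul_le_mul (hC _) (hC _) (norm_nonneg _) hC0)
    have := (tendsto_cesaro_shift_sub hb i).add (hx (h + 1) (by omega))
    simpa only [sub_add_cancel, add_zero, add_assoc] using this
  rcases lt_or_gt_of_ne hij with hlt | hlt
  · exact lt_case i j hlt
  · have := (Complex.continuous_conj.tendsto _).comp (lt_case j i hlt)
    rw [map_zero] at this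
    refine this.congr fun N => ?_
    simp [cesaro, inner_conj_symm]

/-- Van der Corput's lemma: a bounded sequence that is asymptotically orthogonal to each of its
proper shifts has vanishing Cesàro means. -/
theorem tendsto_cesaro_of_correlation {x : ℕ → H} {C : ℝ} (hC : ∀ n, ‖x n‖ ≤ C)
    (hx : ∀ h, 1 ≤ h → Tendsto (cesaro fun n => inner ℂ (x n) (x (n + h))) atTop (𝓝 0)) :
    Tendsto (cesaro x) atTop (𝓝 0) := by
  rw [Metric.tendsto_atTop']
  intro ε hε
  -- The mean of the window sums has squared norm at most `K * C ^ 2` (diagonal) plus `1`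
  -- (off-diagonal, for large `N`); dividing by `K ^ 2` leaves at most `(C ^ 2 + 1) / K`.
  obtain ⟨K, hK0, hK⟩ : ∃ K : ℕ, 0 < K ∧ (C ^ 2 + 1) / K < (ε / 2) ^ 2 := by
    have := (tendsto_const_div_atTop_nhds_zero_nat (C ^ 2 + 1)).eventually_lt_const
      (show (0 : ℝ) < (ε / 2) ^ 2 by positivity)
    obtain ⟨K, h1, h2⟩ := (this.and (eventually_gt_atTop 0)).exists
    exact ⟨K, h2, h1⟩
  have hK0' : (0 : ℝ) < K := by exact_mod_cast hK0
  -- Replacing `x` by its averages over windows of length `K` changes the Cesàro means by `o(1)`.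
  set y : ℕ → H := fun n => ∑ i ∈ Finset.range K, x (n + i) with hy
  have hoff : Tendsto (fun N => ∑ i ∈ Finset.range K, ∑ j ∈ (Finset.range K).erase i,
      cesaro (fun n => inner ℂ (x (n + i)) (x (n + j))) N) atTop (𝓝 0) := by
    rw [show (0 : ℂ) = ∑ i ∈ Finset.range K, ∑ j ∈ (Finset.range K).erase i, 0 by simp]
    exact tendsto_finsetSum _ fun i _ => tendsto_finsetSum _ fun j hj =>
      tendsto_cesaro_inner_shift hC hx (Finset.ne_of_mem_erase hj).symm
  have hcorr : ∀ N, cesaro (fun n => inner ℂ (y n) (y n)) N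
      = ∑ i ∈ Finset.range K, cesaro (fun n => inner ℂ (x (n + i)) (x (n + i))) N
        + ∑ i ∈ Finset.range K, ∑ j ∈ (Finset.range K).erase i,
          cesaro (fun n => inner ℂ (x (n + i)) (x (n + j))) N := by
    intro N
    simp only [hy, sum_inner]
    simp only [inner_sum]
    rw [cesaro_sum, ← Finset.sum_add_distrib]
    refine Finset.sum_congr rfl fun i hi => ?_
    rw [cesaro_sum]
    exact (Finset.add_sum_erase _
      (fun j => cesaro (fun n => inner ℂ (x (n + i)) (x (n + j))) N) hi).symm
  have hdiag : ∀ N, ‖∑ i ∈ Finset.range K,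
      cesaro (fun n => inner ℂ (x (n + i)) (x (n + i))) N‖ ≤ K * C ^ 2 := by
    intro N
    refine (norm_sum_le_of_le _ fun i _ => norm_cesaro_le (C := C ^ 2) (fun n => ?_) N).trans
      (by simp)
    rw [inner_self_eq_norm_sq_to_K, norm_pow]
    simpa using pow_le_pow_left₀ (norm_nonneg _) (hC (n + i)) 2
  have hdiff : Tendsto (fun N => (K : ℂ)⁻¹ • cesaro y N - cesaro x N) atTop (𝓝 0) := by
    have := (tendsto_finsetSum (Finset.range K) fun i _ =>
      tendsto_cesaro_shift_sub hC i).const_smul (K : ℂ)⁻¹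
    simp only [Finset.sum_const_zero, smul_zero] at this
    refine this.congr fun N => ?_
    have hKc : (K : ℂ) ≠ 0 := by exact_mod_cast hK0.ne'
    rw [Finset.sum_sub_distrib, ← cesaro_sum, smul_sub, Finset.sum_const, Finset.card_range,
      ← Nat.cast_smul_eq_nsmul ℂ, smul_smul, inv_mul_cancel₀ hKc, one_smul]
  have e1 := (tendsto_zero_iff_norm_tendsto_zero.1 hoff).eventually_lt_const one_pos
  have e2 := (tendsto_zero_iff_norm_tendsto_zero.1 hdiff).eventually_lt_const (half_pos hε)
  obtain ⟨N₀, hN₀⟩ := eventually_atTop.1 (e1.and e2)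
  refine ⟨N₀, fun N hN => ?_⟩
  obtain ⟨h1, h2⟩ := hN₀ N hN.le
  have hysq : ‖cesaro y N‖ ^ 2 ≤ K * (C ^ 2 + 1) := by
    have hK1 : (1 : ℝ) ≤ K := by exact_mod_cast hK0
    calc ‖cesaro y N‖ ^ 2 ≤ _ := norm_cesaro_sq_le y N
      _ ≤ _ := Complex.re_le_norm _
      _ ≤ K * C ^ 2 + 1 := by
        rw [hcorr]
        exact (norm_add_le _ _).trans (add_le_add (hdiag N) h1.le)
      _ ≤ _ := by nlinarith
  have hyK : ‖(K : ℂ)⁻¹ • cesaro y N‖ < ε / 2 := by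
    refine lt_of_pow_lt_pow_left₀ 2 (half_pos hε).le (lt_of_le_of_lt ?_ hK)
    rw [norm_smul, norm_inv, Complex.norm_natCast, mul_pow]
    calc (K : ℝ)⁻¹ ^ 2 * ‖cesaro y N‖ ^ 2 ≤ (K : ℝ)⁻¹ ^ 2 * (K * (C ^ 2 + 1)) := by gcongr
      _ = _ := by field_simp
  rw [dist_zero_right]
  calc ‖cesaro x N‖ = ‖(K : ℂ)⁻¹ • cesaro y N - ((K : ℂ)⁻¹ • cesaro y N - cesaro x N)‖ := by
        congr 1; abel
    _ ≤ _ := norm_sub_le _ _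
    _ < ε / 2 + ε / 2 := add_lt_add hyK h2
    _ = ε := add_halves ε

end VanDerCorputInequality

/-! ### Polynomial phases and differencing. -/

section PolynomialPhases

/-- The polynomial phase `e^{2πi q(n)}`. -/
noncomputable def phase (q : ℝ[X]) (n : ℕ) : ℂ :=
  Complex.exp (2 * Real.pi * Complex.I * (q.eval (n : ℝ) : ℝ))

theorem norm_phase (q : ℝ[X]) (n : ℕ) : ‖phase q n‖ = 1 := by
  rw [phase, show 2 * (Real.pi : ℂ) * Complex.I * ((q.eval (n : ℝ) : ℝ) : ℂ)
    = ((2 * Real.pi * q.eval (n : ℝ) : ℝ) : ℂ) * Complex.I by push_cast; ring]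
  exact Complex.norm_exp_ofReal_mul_I _

theorem conj_phase_mul_phase_add (q : ℝ[X]) (n h : ℕ) :
    (starRingEnd ℂ) (phase q n) * phase q (n + h) = phase (taylor (h : ℝ) q - q) n := by
  simp only [phase, ← Complex.exp_conj, ← Complex.exp_add, eval_sub, taylor_eval]
  congr 1
  simp [map_ofNat]
  ring

/-- The Taylor coefficient is the `d`-th Hasse derivative at `r`, here affine in `r`; its constant
term `q.coeff d` cancels. -/
theorem coeff_taylor_sub {q : ℝ[X]} {d : ℕ} (hq : q.natDegree ≤ d + 1) (r : ℝ) :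
    (taylor r q - q).coeff d = (d + 1 : ℕ) * (q.coeff (d + 1) * r) := by
  have hdeg : (hasseDeriv d q).natDegree ≤ 1 := by
    refine natDegree_le_iff_coeff_eq_zero.2 fun n hn => ?_
    rw [hasseDeriv_coeff, coeff_eq_zero_of_natDegree_lt (by omega), mul_zero]
  rw [coeff_sub, taylor_coeff, eval_eq_sum_range' (Nat.lt_succ_of_le hdeg)]
  simp [Finset.sum_range_succ, hasseDeriv_coeff, add_comm 1 d]
  ring

theorem natDegree_taylor_sub_le {q : ℝ[X]} {d : ℕ} (hq : q.natDegree ≤ d + 1) (r : ℝ) :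
    (taylor r q - q).natDegree ≤ d := by
  refine natDegree_le_iff_coeff_eq_zero.2 fun n hn => ?_
  rcases lt_or_eq_of_le (Nat.succ_le_of_lt hn) with hlt | rfl
  · have h1 : (taylor r q - q).natDegree ≤ d + 1 :=
      (natDegree_sub_le _ _).trans (by simpa using hq)
    exact coeff_eq_zero_of_natDegree_lt (h1.trans_lt hlt)
  -- The same formula one degree higher involves `q.coeff (d + 2)`, which is zero.
  · rw [coeff_taylor_sub (hq.trans (Nat.le_succ _)),
      coeff_eq_zero_of_natDegree_lt (Nat.lt_succ_of_le hq)]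
    simp

theorem irrational_coeff_taylor_sub {q : ℝ[X]} {d : ℕ} (hq : q.natDegree ≤ d + 1)
    (hirr : Irrational (q.coeff (d + 1))) {h : ℕ} (hh : 1 ≤ h) :
    Irrational ((taylor (h : ℝ) q - q).coeff d) := by
  rw [coeff_taylor_sub hq]
  exact (hirr.mul_natCast (by omega)).natCast_mul (by omega)

/-- The phase is a geometric progression whose ratio is not `1` by irrationality, so its partial
sums are bounded. -/
theorem tendsto_cesaro_phase_linear {q : ℝ[X]} (hq : q.natDegree ≤ 1)
    (hirr : Irrational (q.coeff 1)) : Tendsto (cesaro (phase q)) atTop (𝓝 0) := by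
  set z : ℂ := Complex.exp (2 * Real.pi * Complex.I * (q.coeff 1 : ℝ)) with hz
  have hphase : ∀ n, phase q n = phase q 0 * z ^ n := by
    intro n
    rw [hz, ← Complex.exp_nat_mul, phase, phase, ← Complex.exp_add,
      eval_eq_sum_range' (Nat.lt_succ_of_le hq), eval_eq_sum_range' (Nat.lt_succ_of_le hq)]
    congr 1
    simp [Finset.sum_range_succ]
    ring
  have hnorm : ‖z‖ = 1 := by
    rw [hz, show 2 * (Real.pi : ℂ) * Complex.I * ((q.coeff 1 : ℝ) : ℂ)
      = ((2 * Real.pi * q.coeff 1 : ℝ) : ℂ) * Complex.I by push_cast; ring]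
    exact Complex.norm_exp_ofReal_mul_I _
  have hz1 : z ≠ 1 := by
    intro h
    obtain ⟨m, hm⟩ := Complex.exp_eq_one_iff.1 h
    refine hirr ⟨m, ?_⟩
    have h2 : (2 * Real.pi * Complex.I : ℂ) ≠ 0 := Complex.two_pi_I_ne_zero
    have h3 : ((q.coeff 1 : ℝ) : ℂ) = m := by
      apply mul_left_cancel₀ h2
      rw [hm]; ring
    exact_mod_cast h3.symm
  have hz1' : 0 < ‖z - 1‖ := norm_pos_iff.2 (sub_ne_zero.2 hz1)
  refine tendsto_cesaro_of_norm_sum_le (B := 2 / ‖z - 1‖) fun N => ?_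
  have hsum : (∑ n ∈ Finset.Icc 1 N, phase q n) * (z - 1) = phase q 0 * (z ^ (N + 1) - z) := by
    induction N with
    | zero => simp
    | succ N ih =>
      rw [Finset.sum_Icc_succ_top (by omega), add_mul, ih, hphase (N + 1)]
      ring
  rw [le_div_iff₀ hz1', ← norm_mul, hsum, norm_mul, norm_phase, one_mul]
  refine (norm_sub_le _ _).trans ?_
  rw [norm_pow, hnorm]
  norm_num

end PolynomialPhases

end VanDerCorput

/-! ### Abstract model of `L^∞` inside `L²`, and the induction on the number of factors. -/

namespace VanDerCorput

/-- A commutative monoid `A` with an involution, realised by vectors of a Hilbert space in such a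
way that inner products only depend on `conj a * b`. The example to keep in mind is `L^∞` inside
`L²`. -/
structure VectorModel (A H : Type*) [CommMonoid A] [NormedAddCommGroup H]
    [InnerProductSpace ℂ H] where
  vec : A → H
  conj : A →* A
  conj_conj : ∀ a, conj (conj a) = a
  bound : A → ℝ
  bound_nonneg : ∀ a, 0 ≤ bound a
  bound_mul_le : ∀ a b, bound (a * b) ≤ bound a * bound b
  norm_vec_le : ∀ a, ‖vec a‖ ≤ bound a
  inner_vec : ∀ a b, inner ℂ (vec a) (vec b) = inner ℂ (vec 1) (vec (conj a * b))

namespace VectorModel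

variable {A H : Type*} [CommMonoid A] [NormedAddCommGroup H] [InnerProductSpace ℂ H]
  (M : VectorModel A H)

/-- The mean value functional `a ↦ ⟨a, 1⟩`. -/
noncomputable def mean (a : A) : ℂ := inner ℂ (M.vec 1) (M.vec a)

theorem inner_vec_eq_mean (a b : A) : inner ℂ (M.vec a) (M.vec b) = M.mean (M.conj a * b) :=
  M.inner_vec a b

/-- The automorphisms of `A` that respect the involution, the bound and the mean value. -/
noncomputable def symmetries : Subgroup (MulAut A) where
  carrier := {U | (∀ a, M.bound (U a) = M.bound a) ∧ (∀ a, M.conj (U a) = U (M.conj a)) ∧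
    ∀ a, M.mean (U a) = M.mean a}
  mul_mem' := by
    rintro U V ⟨hU1, hU2, hU3⟩ ⟨hV1, hV2, hV3⟩
    exact ⟨fun a => by simp [hU1, hV1], fun a => by simp [hU2, hV2], fun a => by simp [hU3, hV3]⟩
  one_mem' := by simp
  inv_mem' := by
    rintro U ⟨hU1, hU2, hU3⟩
    refine ⟨fun a => ?_, fun a => ?_, fun a => ?_⟩
    · rw [← hU1, MulAut.apply_inv_self]
    · apply U.injective
      rw [← hU2, MulAut.apply_inv_self, MulAut.apply_inv_self]
    · rw [← hU3, MulAut.apply_inv_self]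

variable {M}

theorem bound_apply {U : MulAut A} (hU : U ∈ M.symmetries) (a : A) : M.bound (U a) = M.bound a :=
  hU.1 a

theorem conj_apply {U : MulAut A} (hU : U ∈ M.symmetries) (a : A) :
    M.conj (U a) = U (M.conj a) :=
  hU.2.1 a

theorem mean_apply {U : MulAut A} (hU : U ∈ M.symmetries) (a : A) : M.mean (U a) = M.mean a :=
  hU.2.2 a

variable {ι : Type*}

theorem exists_bound_prod_le {U : ι → MulAut A} (hU : ∀ i, U i ∈ M.symmetries) (g : ι → A)
    (s : Finset ι) : ∃ C, ∀ n : ℕ, M.bound (∏ i ∈ s, (U i ^ n) (g i)) ≤ C := by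
  classical
  induction s using Finset.induction_on with
  | empty => exact ⟨M.bound 1, fun n => by simp⟩
  | insert a s ha ih =>
    obtain ⟨C, hC⟩ := ih
    refine ⟨M.bound (g a) * C, fun n => ?_⟩
    rw [Finset.prod_insert ha]
    refine (M.bound_mul_le _ _).trans ?_
    rw [bound_apply (pow_mem (hU a) n)]
    exact mul_le_mul_of_nonneg_left (hC n) (M.bound_nonneg _)

variable (M) in
/-- The vectors `U_1^n g_1 ⋯ U_m^n g_m e^{2πi q(n)}`. -/
noncomputable def twistedVec (U : ι → MulAut A) (g : ι → A) (q : ℝ[X]) (s : Finset ι) (n : ℕ) : H :=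
  phase q n • M.vec (∏ i ∈ s, (U i ^ n) (g i))

theorem exists_norm_twistedVec_le {U : ι → MulAut A} (hU : ∀ i, U i ∈ M.symmetries) (g : ι → A)
    (q : ℝ[X]) (s : Finset ι) : ∃ C, ∀ n, ‖M.twistedVec U g q s n‖ ≤ C := by
  obtain ⟨C, hC⟩ := exists_bound_prod_le hU g s
  refine ⟨C, fun n => ?_⟩
  rw [twistedVec, norm_smul, norm_phase, one_mul]
  exact (M.norm_vec_le _).trans (hC n)

theorem inner_twistedVec_add {U : ι → MulAut A} (hU : ∀ i, U i ∈ M.symmetries) (g : ι → A)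
    (q : ℝ[X]) (s : Finset ι) (n h : ℕ) :
    inner ℂ (M.twistedVec U g q s n) (M.twistedVec U g q s (n + h))
      = phase (taylor (h : ℝ) q - q) n *
        M.mean (∏ i ∈ s, (U i ^ n) (M.conj (g i) * (U i ^ h) (g i))) := by
  rw [twistedVec, twistedVec, inner_smul_left, inner_smul_right, inner_vec_eq_mean, ← mul_assoc,
    conj_phase_mul_phase_add, map_prod, ← Finset.prod_mul_distrib]
  congr 2
  refine Finset.prod_congr rfl fun i _ => ?_
  rw [map_mul, conj_apply (pow_mem (hU i) n), pow_add, MulAut.mul_apply]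

/-- Applying `U_a^{-n}` removes one of the automorphisms. -/
theorem mean_prod_insert [DecidableEq ι] {U : ι → MulAut A} (hU : ∀ i, U i ∈ M.symmetries)
    (hcomm : ∀ i j, Commute (U i) (U j)) (g : ι → A) {a : ι} {s : Finset ι} (ha : a ∉ s) (n : ℕ) :
    M.mean (∏ i ∈ insert a s, (U i ^ n) (g i))
      = inner ℂ (M.vec (M.conj (g a)))
        (M.vec (∏ i ∈ s, (((U a)⁻¹ * U i) ^ n) (g i))) := by
  -- The freed factor sits in the conjugate-linear slot, hence its conjugate in the statement.
  rw [inner_vec_eq_mean, M.conj_conj, ← mean_apply (pow_mem (inv_mem (hU a)) n), map_prod,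
    Finset.prod_insert ha]
  congr 2
  · rw [← MulAut.mul_apply, inv_pow, inv_mul_cancel, MulAut.one_apply]
  · refine Finset.prod_congr rfl fun i _ => ?_
    rw [((hcomm a i).inv_left).mul_pow, MulAut.mul_apply]

theorem tendsto_cesaro_inner {x : ℕ → H} (hx : Tendsto (cesaro x) atTop (𝓝 0)) (v : H) :
    Tendsto (cesaro fun n => inner ℂ v (x n)) atTop (𝓝 0) := by
  have h : Tendsto (fun N => inner ℂ v (cesaro x N)) atTop (𝓝 (inner ℂ v 0)) :=
    tendsto_const_nhds.inner hx
  rw [inner_zero_right] at h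
  refine h.congr fun N => ?_
  rw [cesaro, cesaro, inner_smul_right, inner_sum, smul_eq_mul]

/-- The hypothesis ranges over all commuting families because cancelling `U a` replaces each `U i`
by `(U a)⁻¹ * U i`. -/
theorem tendsto_cesaro_mean_of_twistedVec {d : ℕ} {q : ℝ[X]}
    (hvec : ∀ (U : ι → MulAut A), (∀ i, U i ∈ M.symmetries) → (∀ i j, Commute (U i) (U j)) →
      ∀ (g : ι → A) (s : Finset ι), s.card ≤ d →
        Tendsto (cesaro (M.twistedVec U g q s)) atTop (𝓝 0))
    {U : ι → MulAut A} (hU : ∀ i, U i ∈ M.symmetries) (hcomm : ∀ i j, Commute (U i) (U j))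
    (g : ι → A) {s : Finset ι} (hs : s.card ≤ d + 1) :
    Tendsto (cesaro fun n => phase q n * M.mean (∏ i ∈ s, (U i ^ n) (g i))) atTop (𝓝 0) := by
  classical
  rcases s.eq_empty_or_nonempty with rfl | ⟨a, ha⟩
  · have := tendsto_cesaro_inner (hvec U hU hcomm g ∅ (by simp)) (M.vec 1)
    simpa [twistedVec, inner_smul_right, mean] using this
  · rw [← Finset.insert_erase ha]
    have hcard : (s.erase a).card ≤ d := by rw [Finset.card_erase_of_mem ha]; omega
    have := tendsto_cesaro_inner (hvec (fun i => (U a)⁻¹ * U i)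
      (fun i => mul_mem (inv_mem (hU a)) (hU i))
      (fun i j => ((Commute.refl _).mul_right (hcomm a j).inv_left).mul_left
        ((hcomm i a).inv_right.mul_right (hcomm i j))) g (s.erase a) hcard)
      (M.vec (M.conj (g a)))
    refine this.congr fun N => congrArg (cesaro · N) (funext fun n => ?_)
    rw [twistedVec, inner_smul_right, mean_prod_insert hU hcomm g (Finset.notMem_erase a s)]

/-- Differencing lowers the degree bound by one and cancelling an automorphism removes one factor,
so the gap between them survives the induction. -/
theorem tendsto_cesaro_twistedVec (d : ℕ) {q : ℝ[X]} (hq : q.natDegree ≤ d + 1)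
    (hirr : Irrational (q.coeff (d + 1))) {U : ι → MulAut A} (hU : ∀ i, U i ∈ M.symmetries)
    (hcomm : ∀ i j, Commute (U i) (U j)) (g : ι → A) {s : Finset ι} (hs : s.card ≤ d) :
    Tendsto (cesaro (M.twistedVec U g q s)) atTop (𝓝 0) := by
  induction d generalizing q U g s with
  | zero =>
    obtain rfl : s = ∅ := by simpa using hs
    have h := (tendsto_cesaro_phase_linear hq hirr).smul_const (M.vec 1)
    rw [zero_smul] at h
    refine h.congr fun N => ?_
    simp [cesaro, twistedVec, mul_smul, Finset.sum_smul]
  | succ d ih =>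
    obtain ⟨C, hC⟩ := exists_norm_twistedVec_le hU g q s
    refine tendsto_cesaro_of_correlation hC fun h hh => ?_
    simp only [inner_twistedVec_add hU]
    exact tendsto_cesaro_mean_of_twistedVec
      (fun V hV hV' g' s' hs' => ih (natDegree_taylor_sub_le hq _)
        (irrational_coeff_taylor_sub hq hirr hh) hV hV' g' hs') hU hcomm _ hs

/-- The correlations of a twisted sequence whose phase has larger degree than the number of factors
vanish asymptotically. -/
theorem tendsto_cesaro_inner_twistedVec {d : ℕ} {q : ℝ[X]} (hq : q.natDegree ≤ d + 2)
    (hirr : Irrational (q.coeff (d + 2))) {U : ι → MulAut A} (hU : ∀ i, U i ∈ M.symmetries)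
    (hcomm : ∀ i j, Commute (U i) (U j)) (g : ι → A) {s : Finset ι} (hs : s.card ≤ d + 1)
    {h : ℕ} (hh : 1 ≤ h) :
    Tendsto (cesaro fun n => inner ℂ (M.twistedVec U g q s n) (M.twistedVec U g q s (n + h)))
      atTop (𝓝 0) := by
  simp only [inner_twistedVec_add hU]
  exact tendsto_cesaro_mean_of_twistedVec
    (fun V hV hV' g' s' hs' => tendsto_cesaro_twistedVec d (natDegree_taylor_sub_le hq _)
      (irrational_coeff_taylor_sub hq hirr hh) hV hV' g' hs') hU hcomm _ hs

end VectorModel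

end VanDerCorput

/-! ### Koopman automorphisms realise the abstract model. -/

namespace VanDerCorput

section Koopman

variable {X : Type*} [MeasurableSpace X] (μ : Measure X)

/-- The multiplicative monoid of classes of essentially bounded functions. -/
noncomputable def boundedFunctions : Submonoid (X →ₘ[μ] ℂ) where
  carrier := {a | MemLp a ∞ μ}
  mul_mem' := fun {a b} ha hb => (ha.mul hb : MemLp (b * a : X → ℂ) ∞ μ).ae_eq
    ((AEEqFun.coeFn_mul a b).trans (by rw [mul_comm])).symm
  one_mem' := (memLp_top_const (1 : ℂ)).ae_eq AEEqFun.coeFn_one.symm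

variable {μ}

/-- Composition with a measure preserving automorphism, as an automorphism of the monoid of bounded
functions. -/
noncomputable def koopman (S : X ≃ᵐ X) (hS : MeasurePreserving S μ μ) :
    MulAut (boundedFunctions μ) where
  toFun a := ⟨AEEqFun.compMeasurePreserving a.1 S hS,
    (a.2.comp_measurePreserving hS).ae_eq (AEEqFun.coeFn_compMeasurePreserving a.1 hS).symm⟩
  invFun a := ⟨AEEqFun.compMeasurePreserving a.1 S.symm (hS.symm S),
    (a.2.comp_measurePreserving (hS.symm S)).ae_eq
      (AEEqFun.coeFn_compMeasurePreserving a.1 (hS.symm S)).symm⟩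
  left_inv a := by
    ext1
    simp only [← AEEqFun.compMeasurePreserving_comp]
    simp
  right_inv a := by
    ext1
    simp only [← AEEqFun.compMeasurePreserving_comp]
    simp
  map_mul' a b := by
    ext1
    obtain ⟨a, ha⟩ := a
    obtain ⟨b, hb⟩ := b
    induction a using AEEqFun.induction_on
    induction b using AEEqFun.induction_on
    rfl

theorem coe_koopman_pow (S : X ≃ᵐ X) (hS : MeasurePreserving S μ μ) (a : boundedFunctions μ)
    (n : ℕ) :
    (((koopman S hS ^ n) a : boundedFunctions μ) : X →ₘ[μ] ℂ)
      = AEEqFun.compMeasurePreserving a.1 (S^[n]) (hS.iterate n) := by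
  rw [← AEEqFun.compMeasurePreserving_iterate (hf := hS)]
  induction n with
  | zero => rfl
  | succ n ih => rw [pow_succ', MulAut.mul_apply, Function.iterate_succ_apply', ← ih]; rfl

/-- On classes modulo null sets, commutation almost everywhere becomes exact commutation. -/
theorem commute_koopman {S T : X ≃ᵐ X} (hS : MeasurePreserving S μ μ)
    (hT : MeasurePreserving T μ μ) (h : ∀ᵐ x ∂μ, S (T x) = T (S x)) :
    Commute (koopman S hS) (koopman T hT) := by
  ext1 a
  ext1
  change AEEqFun.compMeasurePreserving (AEEqFun.compMeasurePreserving a.1 T hT) S hS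
    = AEEqFun.compMeasurePreserving (AEEqFun.compMeasurePreserving a.1 S hS) T hT
  rw [← AEEqFun.compMeasurePreserving_comp, ← AEEqFun.compMeasurePreserving_comp]
  exact AEEqFun.compMeasurePreserving_congr _ _ (hS.comp hT).measurable
    (h.mono fun x hx => hx.symm)

variable (μ) in
/-- Complex conjugation of bounded functions. -/
noncomputable def boundedConj : boundedFunctions μ →* boundedFunctions μ where
  toFun a := ⟨star a.1, (a.2.star).ae_eq (AEEqFun.coeFn_star a.1).symm⟩
  map_one' := by
    ext1
    refine AEEqFun.ext ?_
    filter_upwards [AEEqFun.coeFn_star (1 : X →ₘ[μ] ℂ),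
      AEEqFun.coeFn_one (α := X) (μ := μ) (β := ℂ)] with x h1 h2
    simp [h1, h2]
  map_mul' a b := by
    ext1
    refine AEEqFun.ext ?_
    filter_upwards [AEEqFun.coeFn_star (a.1 * b.1), AEEqFun.coeFn_mul a.1 b.1,
      AEEqFun.coeFn_star a.1, AEEqFun.coeFn_star b.1,
      AEEqFun.coeFn_mul (star a.1) (star b.1)] with x h1 h2 h3 h4 h5
    simp [h1, h2, h3, h4, h5]

theorem coeFn_boundedConj (a : boundedFunctions μ) :
    ((boundedConj μ a).1 : X → ℂ) =ᵐ[μ] fun x => (starRingEnd ℂ) (a.1 x) :=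
  AEEqFun.coeFn_star a.1

theorem inner_toLp_toLp {f g : X → ℂ} (hf : MemLp f 2 μ) (hg : MemLp g 2 μ) :
    inner ℂ hf.toLp hg.toLp = ∫ x, (starRingEnd ℂ) (f x) * g x ∂μ := by
  rw [L2.inner_def]
  refine integral_congr_ae ?_
  filter_upwards [hf.coeFn_toLp, hg.coeFn_toLp] with x h1 h2
  rw [h1, h2, RCLike.inner_apply, mul_comm]

theorem eLpNorm_top_mul_le (a b : X →ₘ[μ] ℂ) :
    eLpNorm (a * b : X →ₘ[μ] ℂ) ∞ μ ≤ eLpNorm a ∞ μ * eLpNorm b ∞ μ := by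
  rw [eLpNorm_congr_ae (AEEqFun.coeFn_mul a b)]
  exact eLpNorm_smul_le_mul_eLpNorm (p := ∞) (q := ∞) (r := ∞) (φ := (a : X → ℂ))
    b.aestronglyMeasurable a.aestronglyMeasurable

variable [IsProbabilityMeasure μ]

theorem memLp_two (a : boundedFunctions μ) : MemLp a.1 2 μ := MemLp.mono_exponent a.2 le_top

/-- A bounded function as a vector of `L²`. -/
noncomputable def boundedVec (a : boundedFunctions μ) : Lp ℂ 2 μ := (memLp_two a).toLp

theorem inner_boundedVec (a b : boundedFunctions μ) :
    inner ℂ (boundedVec a) (boundedVec b) = ∫ x, (boundedConj μ a * b).1 x ∂μ := by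
  refine (inner_toLp_toLp (memLp_two a) (memLp_two b)).trans (integral_congr_ae ?_)
  filter_upwards [coeFn_boundedConj a, AEEqFun.coeFn_mul (boundedConj μ a).1 b.1] with x h1 h2
  rw [Submonoid.coe_mul, h2, Pi.mul_apply, h1]

variable (μ) in
/-- Bounded functions as vectors of `L²`. -/
noncomputable def boundedModel : VectorModel (boundedFunctions μ) (Lp ℂ 2 μ) where
  vec := boundedVec
  conj := boundedConj μ
  conj_conj a := Subtype.ext (star_star a.1)
  bound a := (eLpNorm a.1 ∞ μ).toReal
  bound_nonneg a := ENNReal.toReal_nonneg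
  bound_mul_le a b := by
    rw [← ENNReal.toReal_mul]
    exact ENNReal.toReal_mono (ENNReal.mul_ne_top a.2.2.ne b.2.2.ne) (eLpNorm_top_mul_le a.1 b.1)
  norm_vec_le a := by
    rw [boundedVec, Lp.norm_toLp]
    exact ENNReal.toReal_mono a.2.2.ne (eLpNorm_le_eLpNorm_of_exponent_le le_top a.2.1)
  inner_vec a b := by rw [inner_boundedVec, inner_boundedVec, map_one, one_mul]

theorem boundedModel_mean (a : boundedFunctions μ) : (boundedModel μ).mean a = ∫ x, a.1 x ∂μ := by
  refine (inner_boundedVec 1 a).trans ?_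
  rw [map_one, one_mul]

theorem koopman_mem_symmetries (S : X ≃ᵐ X) (hS : MeasurePreserving S μ μ) :
    koopman S hS ∈ (boundedModel μ).symmetries := by
  have hcoe : ∀ a : boundedFunctions μ, ((koopman S hS a).1 : X → ℂ) =ᵐ[μ] a.1 ∘ S :=
    fun a => AEEqFun.coeFn_compMeasurePreserving a.1 hS
  refine ⟨fun a => ?_, fun a => ?_, fun a => ?_⟩
  · change (eLpNorm (koopman S hS a).1 ∞ μ).toReal = (eLpNorm a.1 ∞ μ).toReal
    rw [eLpNorm_congr_ae (hcoe a), eLpNorm_comp_measurePreserving a.2.1 hS]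
  · refine Subtype.ext (AEEqFun.ext ?_)
    change ((boundedConj μ (koopman S hS a)).1 : X → ℂ) =ᵐ[μ] (koopman S hS (boundedConj μ a)).1
    filter_upwards [coeFn_boundedConj (koopman S hS a), hcoe a, hcoe (boundedConj μ a),
      hS.quasiMeasurePreserving.ae (coeFn_boundedConj a)] with x h1 h2 h3 h4
    rw [h1, h2, h3, Function.comp_apply, Function.comp_apply, h4]
  · rw [boundedModel_mean, boundedModel_mean, integral_congr_ae (hcoe a)]
    exact hS.integral_comp S.measurableEmbedding _

/-- An essentially bounded function as an element of `boundedFunctions`. -/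
noncomputable def ofLpTop (f : Lp ℂ ∞ μ) : boundedFunctions μ := ⟨f.1, Lp.memLp f⟩

theorem twistedProduct_eq_twistedVec {m : ℕ} (S : Fin m → X ≃ᵐ X)
    (hS : ∀ i, MeasurePreserving (S i) μ μ) (f : Fin m → Lp ℂ ∞ μ) (p : ℝ[X]) (n : ℕ) :
    twistedProduct S hS f p n = (boundedModel μ).twistedVec (fun i => koopman (S i) (hS i))
      (fun i => ofLpTop (f i)) p Finset.univ n := by
  rw [twistedProduct, VectorModel.twistedVec]
  change _ = phase p n • (memLp_two _).toLp
  rw [← MemLp.toLp_const_smul, MemLp.toLp_eq_toLp_iff]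
  have h1 : ∀ i, (((koopman (S i) (hS i) ^ n) (ofLpTop (f i))).1 : X → ℂ)
      =ᵐ[μ] f i ∘ (S i)^[n] := by
    intro i
    rw [coe_koopman_pow]
    exact AEEqFun.coeFn_compMeasurePreserving _ ((hS i).iterate n)
  filter_upwards [AEEqFun.coeFn_fun_finsetProd Finset.univ
    (fun i => ((koopman (S i) (hS i) ^ n) (ofLpTop (f i))).1), ae_all_iff.2 h1] with x h2 h3
  rw [Pi.smul_apply, Submonoid.coe_finsetProd, h2, Finset.prod_congr rfl fun i _ => h3 i,
    smul_eq_mul, mul_comm]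
  rfl

end Koopman

/-! ### From vanishing correlations to Lebesgue spectrum. -/

section SpectralMeasure

theorem measureFourierCoeff_smul_volume (c : ℝ≥0∞) (h : ℕ) :
    measureFourierCoeff (c • volume.restrict (Set.Icc 0 1)) h
      = if h = 0 then (c.toReal : ℂ) else 0 := by
  rw [measureFourierCoeff, integral_smul_measure, integral_Icc_eq_integral_Ioc,
    ← intervalIntegral.integral_of_le zero_le_one]
  split_ifs with hh
  · simp [hh]
  · have hc : -(2 * Real.pi * Complex.I * h) ≠ 0 :=
      neg_ne_zero.2 (mul_ne_zero Complex.two_pi_I_ne_zero (by exact_mod_cast hh))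
    have : ∀ x : ℝ, -(2 * Real.pi * Complex.I * ((h : ℤ) : ℂ) * x)
        = -(2 * Real.pi * Complex.I * h) * x := fun x => by push_cast; ring
    simp only [this]
    rw [integral_exp_mul_complex hc]
    have h1 : Complex.exp (-(2 * Real.pi * Complex.I * h) * (1 : ℝ)) = 1 :=
      Complex.exp_eq_one_iff.2 ⟨-h, by push_cast; ring⟩
    rw [h1]
    simp

theorem squareAverageable_of_norm_le {H : Type*} [NormedAddCommGroup H] {x : ℕ → H} {C : ℝ} (hC : ∀ n, ‖x n‖ ≤ C) :
    SquareAverageable x := by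
  refine isBoundedUnder_of ⟨C ^ 2, fun N => ?_⟩
  rcases Nat.eq_zero_or_pos N with rfl | hN
  · simpa using sq_nonneg C
  have hN' : (0 : ℝ) < N := by exact_mod_cast hN
  rw [one_div, inv_mul_le_iff₀ hN']
  calc ∑ n ∈ Finset.Icc 1 N, ‖x n‖ ^ 2 ≤ ∑ n ∈ Finset.Icc 1 N, C ^ 2 :=
        Finset.sum_le_sum fun n _ => pow_le_pow_left₀ (norm_nonneg _) (hC n) 2
    _ = N * C ^ 2 := by simp

variable {H : Type*} [NormedAddCommGroup H] [InnerProductSpace ℂ H]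

theorem correlationAverage_eq_cesaro (x : ℕ → H) (h N : ℕ) :
    correlationAverage x x h N = cesaro (fun n => inner ℂ (x n) (x (n + h))) N := by
  simp [correlationAverage, cesaro]

/-- A bounded sequence whose nontrivial correlations vanish has a multiple of Lebesgue measure as
its spectral measure. -/
theorem spectrallyLebesgue_of_correlation {x : ℕ → H} {C : ℝ} (hC : ∀ n, ‖x n‖ ≤ C)
    (hx : ∀ h, 1 ≤ h → Tendsto (cesaro fun n => inner ℂ (x n) (x (n + h))) atTop (𝓝 0)) :
    SpectrallyLebesgue x := by
  refine ⟨squareAverageable_of_norm_le hC, fun N hN => ?_⟩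
  -- The lag-zero limit is a limit of means of squared norms, hence real and nonnegative; it is the
  -- total mass of the measure.
  obtain ⟨c, hc⟩ := hN.exists_limit x (by simp) x (by simp) 0
  have hform : ∀ M : ℕ, correlationAverage x x 0 M
      = (((M : ℝ)⁻¹ * ∑ n ∈ Finset.Icc 1 M, ‖x n‖ ^ 2 : ℝ) : ℂ) := fun M => by
    simp [correlationAverage, inner_self_eq_norm_sq_to_K]
  have hre := (Complex.continuous_re.tendsto c).comp hc
  have him := (Complex.continuous_im.tendsto c).comp hc
  have hc_re : 0 ≤ c.re := ge_of_tendsto' hre fun q => by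
    simp only [Function.comp_apply, hform, Complex.ofReal_re]
    positivity
  have hc_im : c.im = 0 := tendsto_nhds_unique him <| by
    simp only [Function.comp_def, hform, Complex.ofReal_im]
    exact tendsto_const_nhds
  refine ⟨ENNReal.ofReal c.re • volume.restrict (Set.Icc 0 1),
    Measure.smul_finite _ ENNReal.ofReal_ne_top, Measure.smul_absolutelyContinuous, fun h => ?_⟩
  rw [measureFourierCoeff_smul_volume, inducedInner]
  split_ifs with hh
  · subst hh
    rw [hc.limUnder_eq, ENNReal.toReal_ofReal hc_re]
    exact Complex.ext rfl hc_im
  · simp only [correlationAverage_eq_cesaro]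
    exact ((hx h (Nat.one_le_iff_ne_zero.2 hh)).comp hN.strictMono.tendsto_atTop).limUnder_eq

end SpectralMeasure

end VanDerCorput

theorem mainTheorem9 {X : Type*} [MeasurableSpace X] (μ : Measure X) [IsProbabilityMeasure μ]
    (k : ℕ) (hk : 2 ≤ k)
    (S : Fin (k - 1) → X ≃ᵐ X) (hS : ∀ i, MeasurePreserving (S i) μ μ)
    (hcomm : ∀ i j, ∀ᵐ x ∂μ, S i (S j x) = S j (S i x))
    (p : ℝ[X]) (hdeg : k ≤ p.natDegree) (hlead : Irrational p.leadingCoeff)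
    (f : Fin (k - 1) → Lp ℂ ∞ μ) :
    VanDerCorput.SpectrallyLebesgue (VanDerCorput.twistedProduct S hS f p) := by
  have hsymm : ∀ i, VanDerCorput.koopman (S i) (hS i) ∈ (VanDerCorput.boundedModel μ).symmetries :=
    fun i => VanDerCorput.koopman_mem_symmetries (S i) (hS i)
  have hcomm' : ∀ i j, Commute (VanDerCorput.koopman (S i) (hS i)) (VanDerCorput.koopman (S j) (hS j)) :=
    fun i j => VanDerCorput.commute_koopman (hS i) (hS j) (hcomm i j)
  -- With degree `d + 2 ≥ k`, the `k - 1` factors number at most `d + 1`.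
  obtain ⟨d, hd⟩ : ∃ d, p.natDegree = d + 2 := ⟨p.natDegree - 2, by omega⟩
  have hirr : Irrational (p.coeff (d + 2)) := by rwa [← hd]
  obtain ⟨C, hC⟩ := VanDerCorput.VectorModel.exists_norm_twistedVec_le hsymm (fun i => VanDerCorput.ofLpTop (f i)) p
    Finset.univ
  rw [funext fun n => VanDerCorput.twistedProduct_eq_twistedVec S hS f p n]
  exact VanDerCorput.spectrallyLebesgue_of_correlation hC fun h hh =>
    VanDerCorput.VectorModel.tendsto_cesaro_inner_twistedVec hd.le hirr hsymm hcomm' _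
      (by rw [Finset.card_univ, Fintype.card_fin]; omega) hh
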